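/- **Theorem 4.6 (Minimizer of the ALS averaged residual function).** *Setting.* Let $n_L,n_N,n_R$ be the mode sizes of three-dimensional real tensors. A tensor $A$ is written through its slices $A(j)\in\mathbb R^{n_L\times n_R}$, $j=1,\dots,n_N$. For $L\in\mathbb R^{n_L\times r_L}$, $N=(N(j))_{j=1}^{n_N}$ with $N(j)\in\mathbb R^{r_L\times r_R}$, and $R\in\mathbb R^{r_R\times n_R}$, let $LNR$ be the tensor with slices $L\,N(j)\,R$. Norms $\|\cdot\|$ are Frobenius norms. For a tensor $H$ and a set $S$ of positions, $\|H\|_S^2$ is the sum of the squares of the entries of $H$ at the positions in $S$; similarly for matrices. Let $(\mathcal L,\Sigma_L,\mathcal N,\Sigma_R,\mathcal R)$ be a standard representation of $A$. This means that $A=\mathcal L(\Sigma_L\mathcal N\Sigma_R)\mathcal R$ and that $\mathcal L\cdot\Sigma_L\cdot[\mathcal N\Sigma_R\mathcal R]_{\rm right}$ and $[\mathcal L\Sigma_L\mathcal N]_{\rm left}\cdot\Sigma_R\cdot\mathcal R$ are truncated singular value decompositions of $A^{(\{1\})}\in\mathbb R^{n_L\times(n_Nn_R)}$ and $A^{(\{1,2\})}\in\mathbb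 R^{(n_Ln_N)\times n_R}$. Truncated means that only the positive singular values are kept, in decreasing order, with orthonormal singular vectors. Here $[\cdot]_{\rm left}$ and $[\cdot]_{\rm right}$ stack the slices vertically and horizontally, respectively. Let $B$ be a tensor, let $S$ be a set of positions $(a,j,b)$, and put $S(j)=\{(a,b):(a,j,b)\in S\}$. Let $\omega>0$ and $\gamma_L,\gamma_R>0$. With $L=\mathcal L$, $N=\Sigma_L\mathcal N\Sigma_R$, $R=\mathcal R$ define the averaged residual function $$C(\widetilde N)=\int_{\mathbb V_\omega}\big\|(L+\gamma_L\Delta L)(\widetilde N+\Delta N)(R+\gamma_R\Delta R)-B\big\|_S^2\,d\Delta L\,d\Delta N\,d\Delta R,$$ $$\mathbb V_\omega=\{(\Delta L,\Delta N,\Delta R):\|\Delta L\,N\,R\|^2+\|L\,\Delta N\,R\|^2+\|L\,N\,\Delta R\|^2\le\omega^2\}.$$ *Constants.* Put $\#_L=n_Lr_L$, $\#_N=r_Ln_Nr_R$, $\#_R=r_Rn_R$, $D=\#_L+\#_N+\#_R$, and $$\zeta_1=\frac{\omega^2\gamma_L^2\,\#_L}{r_L(D+2)},\quad \zeta_2=\frac{\omega^2\gamma_R^2\,\#_R}{r_R(D+2)},\quad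 \zeta_{1,2}=\frac{\omega^4\gamma_L^2\gamma_R^2\,\#_R\#_L}{r_Lr_R(D+2)(D+4)},\quad \rho_{1,2}=\frac{|S(j)|}{n_Ln_R}.$$ With $S(j)=\{x^{(1)},x^{(2)},\dots\}$, let $\mathcal L_{S(j)_1,-}$ be the matrix whose rows are the rows of $\mathcal L$ with indices $x^{(1)}_1,x^{(2)}_1,\dots$. Let $\mathcal R_{-,S(j)_2}$ be the matrix whose columns are the columns of $\mathcal R$ with indices $x^{(1)}_2,x^{(2)}_2,\dots$. With the matrix Kronecker product $\otimes$ put $$Y(j)=\begin{pmatrix}\sqrt{n_L^{-1}\zeta_1}\;\mathcal R_{-,S(j)_2}^T\otimes\Sigma_L^{-1}\\ \sqrt{n_R^{-1}\zeta_2}\;\Sigma_R^{-1}\otimes\mathcal L_{S(j)_1,-}\\ \sqrt{\rho_{1,2}\zeta_{1,2}}\;\Sigma_R^{-1}\otimes\Sigma_L^{-1}\end{pmatrix},\qquad F_j(X)=\|\mathcal L X\mathcal R-B(j)\|_{S(j)}^2+\|Y(j)\operatorname{vec}(X)\|^2,$$ where $\operatorname{vec}$ stacks columns. *Claim.* The integral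 defining $C(\widetilde N)$ exists for every $\widetilde N$. A core $N^+$ minimizes $C$ if and only if, for every $j$, the slice $N^+(j)$ minimizes the regularized standard ALS objective $F_j$ over $\mathbb R^{r_L\times r_R}$. For every $j$ with $S(j)\neq\emptyset$ the minimizer of $F_j$ is unique. If among all minimizers of $C$ one takes those of smallest $\|\mathcal L\widetilde N\mathcal R\|$, and among the minimizers of $F_j$ those of smallest $\|\mathcal LX\mathcal R\|$, then the minimizers $N^+$ of $C$ and $N^+(j)$ of $F_j$ are unique in all cases and $$N^+(j)=\operatorname*{argmin}_{X}\ \|\mathcal L X\mathcal R-B(j)\|_{S(j)}^2+\|Y(j)\operatorname{vec}(X)\|^2,\qquad j=1,\dots,n_N.$$ -/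

import Mathlib

open scoped Kronecker

namespace TTALS

/-- A core: a vector of `n` matrices of size `k₁ × k₂`.  Three-dimensional real tensors `A` of mode
size `(k₁, n, k₂)` are written in this form, with `A j a b` the entry at position `(a, j, b)`. -/
abbrev Core (n k₁ k₂ : ℕ) : Type := Fin n → Matrix (Fin k₁) (Fin k₂) ℝ

/-- Left unfolding of a core, with row index `(ℓ, j)`. -/
def leftUnfold {n k₁ k₂ : ℕ} (H : Core n k₁ k₂) : Matrix (Fin k₁ × Fin n) (Fin k₂) ℝ :=
  Matrix.of fun p q => H p.2 p.1 q

/-- Right unfolding of a core, with column index `(q, j)`. -/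
def rightUnfold {n k₁ k₂ : ℕ} (H : Core n k₁ k₂) : Matrix (Fin k₁) (Fin k₂ × Fin n) ℝ :=
  Matrix.of fun l p => H p.2 l p.1

/-- The tensor generated by a representation `(L, N, R)`: its `j`-th slice is `L N(j) R`. -/
def tau {nL nN nR rL rR : ℕ} (L : Matrix (Fin nL) (Fin rL) ℝ) (N : Core nN rL rR)
    (R : Matrix (Fin rR) (Fin nR) ℝ) : Core nN nL nR :=
  fun j => L * N j * R

/-- `A = U diag(σ) W` is a truncated singular value decomposition: orthonormal columns of `U`,
orthonormal rows of `W`, and positive singular values in decreasing order. -/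
structure IsTruncatedSVD {m n : Type*} [Fintype m] [Fintype n] {r : ℕ} (A : Matrix m n ℝ)
    (U : Matrix m (Fin r) ℝ) (σ : Fin r → ℝ) (W : Matrix (Fin r) n ℝ) : Prop where
  col_orthogonal : U.transpose * U = 1
  row_orthogonal : W * W.transpose = 1
  pos : ∀ i, 0 < σ i
  antitone : Antitone σ
  eq : A = U * Matrix.diagonal σ * W

/-- The core `Σ_L N Σ_R` with slices `diag(σL) N(j) diag(σR)`. -/
def scaledCore {nN rL rR : ℕ} (σL : Fin rL → ℝ) (N : Core nN rL rR) (σR : Fin rR → ℝ) :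
    Core nN rL rR :=
  fun j => Matrix.diagonal σL * N j * Matrix.diagonal σR

/-- `(L, Σ_L, N, Σ_R, R)` is a standard representation of the tensor `A`.  The unfoldings
`rightUnfold A` and `leftUnfold A` are the matricizations `A^({1})` and `A^({1,2})`. -/
structure IsStandardRep {nL nN nR rL rR : ℕ} (A : Core nN nL nR)
    (L : Matrix (Fin nL) (Fin rL) ℝ) (σL : Fin rL → ℝ) (N : Core nN rL rR) (σR : Fin rR → ℝ)
    (R : Matrix (Fin rR) (Fin nR) ℝ) : Prop where
  eq_tau : A = tau L (scaledCore σL N σR) R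
  svd_left : IsTruncatedSVD (rightUnfold A) L σL
    (rightUnfold fun j => N j * Matrix.diagonal σR * R)
  svd_right : IsTruncatedSVD (leftUnfold A) (leftUnfold fun j => L * Matrix.diagonal σL * N j)
    σR R

/-- Squared Frobenius norm of a matrix. -/
def frobSq {m n : Type*} [Fintype m] [Fintype n] (X : Matrix m n ℝ) : ℝ :=
  ∑ a, ∑ b, X a b ^ 2

/-- Squared Frobenius norm of a core or tensor. -/
def coreFrobSq {n k₁ k₂ : ℕ} (H : Core n k₁ k₂) : ℝ := ∑ j, frobSq (H j)

/-- `‖H‖²_S`, the sum of the squared entries of `H` at the positions `(a, j, b) ∈ S`. -/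
def sampledSq {nL nN nR : ℕ} (S : Finset (Fin nL × Fin nN × Fin nR)) (H : Core nN nL nR) : ℝ :=
  ∑ p ∈ S, H p.2.1 p.1 p.2.2 ^ 2

/-- The slice `S(j)` of a sampling set: the pairs `(a, b)` with `(a, j, b) ∈ S`. -/
def slice {nL nN nR : ℕ} (S : Finset (Fin nL × Fin nN × Fin nR)) (j : Fin nN) :
    Finset (Fin nL × Fin nR) :=
  Finset.univ.filter fun p => (p.1, j, p.2) ∈ S

/-- The space of variations `(ΔL, ΔN, ΔR)`, with matrices as families of rows, so that `volume` is
Lebesgue measure on all the entries. -/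
abbrev Variation (nL nN nR rL rR : ℕ) : Type :=
  (Fin nL → Fin rL → ℝ) × (Fin nN → Fin rL → Fin rR → ℝ) × (Fin rR → Fin nR → ℝ)

section Variation

variable {nL nN nR rL rR : ℕ}

/-- `ΔL` as a matrix. -/
def Variation.left (δ : Variation nL nN nR rL rR) : Matrix (Fin nL) (Fin rL) ℝ :=
  Matrix.of δ.1

/-- `ΔN` as a core. -/
def Variation.mid (δ : Variation nL nN nR rL rR) : Core nN rL rR :=
  fun j => Matrix.of (δ.2.1 j)

/-- `ΔR` as a matrix. -/
def Variation.right (δ : Variation nL nN nR rL rR) : Matrix (Fin rR) (Fin nR) ℝ :=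
  Matrix.of δ.2.2

/-- The set of variations
`𝕍_ω(L, N, R) = {(ΔL, ΔN, ΔR) | ‖ΔL N R‖² + ‖L ΔN R‖² + ‖L N ΔR‖² ≤ ω²}`. -/
def variationSet (ω : ℝ) (L : Matrix (Fin nL) (Fin rL) ℝ) (N : Core nN rL rR)
    (R : Matrix (Fin rR) (Fin nR) ℝ) : Set (Variation nL nN nR rL rR) :=
  {δ | coreFrobSq (tau δ.left N R) + coreFrobSq (tau L δ.mid R) + coreFrobSq (tau L N δ.right)
    ≤ ω ^ 2}

/-- The varied residual `‖(L + γL ΔL) (X + ΔN) (R + γR ΔR) - B‖²_S`. -/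
def variedResidual (γL γR : ℝ) (B : Core nN nL nR) (S : Finset (Fin nL × Fin nN × Fin nR))
    (L : Matrix (Fin nL) (Fin rL) ℝ) (R : Matrix (Fin rR) (Fin nR) ℝ) (X : Core nN rL rR)
    (δ : Variation nL nN nR rL rR) : ℝ :=
  sampledSq S (tau (L + γL • δ.left) (X + δ.mid) (R + γR • δ.right) - B)

/-- The averaged residual function `C_{B,S,L,N,R}`, evaluated at `X`. -/
noncomputable def averagedResidual (ω γL γR : ℝ) (B : Core nN nL nR)
    (S : Finset (Fin nL × Fin nN × Fin nR)) (L : Matrix (Fin nL) (Fin rL) ℝ) (N : Core nN rL rR)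
    (R : Matrix (Fin rR) (Fin nR) ℝ) (X : Core nN rL rR) : ℝ :=
  ∫ δ in variationSet ω L N R, variedResidual γL γR B S L R X δ

end Variation

/-- `#L + #N + #R`, the total number of entries of a representation. -/
def totalSize (nL nN nR rL rR : ℕ) : ℕ := nL * rL + rL * nN * rR + rR * nR

/-- `ζ₁ = ω² γL² #L / (rL (#L + #N + #R + 2))`. -/
noncomputable def zeta₁ (nL nN nR rL rR : ℕ) (ω γL : ℝ) : ℝ :=
  ω ^ 2 * γL ^ 2 * ((nL * rL : ℕ) : ℝ) / ((rL : ℝ) * ((totalSize nL nN nR rL rR : ℝ) + 2))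

/-- `ζ₂ = ω² γR² #R / (rR (#L + #N + #R + 2))`. -/
noncomputable def zeta₂ (nL nN nR rL rR : ℕ) (ω γR : ℝ) : ℝ :=
  ω ^ 2 * γR ^ 2 * ((rR * nR : ℕ) : ℝ) / ((rR : ℝ) * ((totalSize nL nN nR rL rR : ℝ) + 2))

/-- `ζ₁₂ = ω⁴ γL² γR² #R #L / (rL rR (#L + #N + #R + 2) (#L + #N + #R + 4))`. -/
noncomputable def zeta₁₂ (nL nN nR rL rR : ℕ) (ω γL γR : ℝ) : ℝ :=
  ω ^ 4 * γL ^ 2 * γR ^ 2 * (((rR * nR : ℕ) : ℝ) * ((nL * rL : ℕ) : ℝ)) /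
    ((rL : ℝ) * (rR : ℝ) * ((totalSize nL nN nR rL rR : ℝ) + 2)
      * ((totalSize nL nN nR rL rR : ℝ) + 4))

/-- `ρ₁₂ = |S(j)| nL⁻¹ nR⁻¹`. -/
noncomputable def rho₁₂ {nL nN nR : ℕ} (S : Finset (Fin nL × Fin nN × Fin nR)) (j : Fin nN) : ℝ :=
  ((slice S j).card : ℝ) * (nL : ℝ)⁻¹ * (nR : ℝ)⁻¹

/-- The matrix `Y(j)`, with the three row blocks
`√(nL⁻¹ ζ₁) R_{-,S(j)₂}ᵀ ⊗ Σ_L⁻¹`, `√(nR⁻¹ ζ₂) Σ_R⁻¹ ⊗ L_{S(j)₁,-}`, `√(ρ₁₂ ζ₁₂) Σ_R⁻¹ ⊗ Σ_L⁻¹`.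
The rows of the sampled factors are indexed by the elements of `S(j)`. -/
noncomputable def regMatrix {nL nN nR rL rR : ℕ} (ω γL γR : ℝ)
    (S : Finset (Fin nL × Fin nN × Fin nR)) (L : Matrix (Fin nL) (Fin rL) ℝ) (σL : Fin rL → ℝ)
    (σR : Fin rR → ℝ) (R : Matrix (Fin rR) (Fin nR) ℝ) (j : Fin nN) :
    Matrix ((slice S j × Fin rL) ⊕ (Fin rR × slice S j) ⊕ (Fin rR × Fin rL))
      (Fin rR × Fin rL) ℝ :=
  Matrix.fromRows
    (√((nL : ℝ)⁻¹ * zeta₁ nL nN nR rL rR ω γL) •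
      ((R.submatrix id fun p : slice S j => p.1.2).transpose ⊗ₖ (Matrix.diagonal σL)⁻¹))
    (Matrix.fromRows
      (√((nR : ℝ)⁻¹ * zeta₂ nL nN nR rL rR ω γR) •
        ((Matrix.diagonal σR)⁻¹ ⊗ₖ (L.submatrix (fun p : slice S j => p.1.1) id)))
      (√(rho₁₂ S j * zeta₁₂ nL nN nR rL rR ω γL γR) •
        ((Matrix.diagonal σR)⁻¹ ⊗ₖ (Matrix.diagonal σL)⁻¹)))

/-- The regularized least-squares objective of slice `j`,
`‖L X R - B(j)‖²_{S(j)} + ‖Y(j) vec(X)‖²`.  Here `Matrix.vec` stacks columns. -/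
noncomputable def sliceObjective {nL nN nR rL rR : ℕ} (ω γL γR : ℝ) (B : Core nN nL nR)
    (S : Finset (Fin nL × Fin nN × Fin nR)) (L : Matrix (Fin nL) (Fin rL) ℝ) (σL : Fin rL → ℝ)
    (σR : Fin rR → ℝ) (R : Matrix (Fin rR) (Fin nR) ℝ) (j : Fin nN)
    (X : Matrix (Fin rL) (Fin rR) ℝ) : ℝ :=
  (∑ p ∈ slice S j, (L * X * R - B j) p.1 p.2 ^ 2) +
    ∑ i, ((regMatrix ω γL γR S L σL σR R j).mulVec X.vec) i ^ 2

/-- `x` minimizes `f`, and minimizes the secondary criterion `g` among the minimizers of `f`. -/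
def IsArgmin {α : Type*} (f g : α → ℝ) (x : α) : Prop :=
  IsMinOn f Set.univ x ∧ IsMinOn g {y | IsMinOn f Set.univ y} x

end TTALS

/-!
For a standard representation the set of variations is an ellipsoid: the right factor of the first
singular value decomposition has orthonormal rows and the left factor of the second has orthonormal
columns, so the three squared norms are `‖ΔL Σ_L‖²`, `‖ΔN‖²` and `‖Σ_R ΔR‖²`
(`IsStandardRep.variationSet_eq`). Rescaling each entry turns it into the Euclidean unit ball of
dimension `D`, and Lebesgue measure only changes by a positive constant.

At one sampled position the residual is a polynomial of degree at most one in each entry of the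
variation. When its square is integrated over the ball, sign changes of the entries remove all cross
terms; the part containing `ΔN` contributes a number independent of the core, and the remaining
terms need only the moments `∫ yᵢ² = vol / (D + 2)` and `∫ yᵢ² yₖ² = vol / ((D + 2) (D + 4))`
(`integral_sq_entry`). These follow from Gaussian integrals: for a homogeneous function `p` of
degree `d`, the integral of `p(y) e^{-|y|²}` over the whole space is `Γ((D + d) / 2 + 1)` times the
integral of `p` over the ball (`gaussian_integral_eq_Gamma_mul`).

Collecting the entries of a slice gives exactly its regularized objective, so that the averaged
residual function is `C + c ∑ⱼ Fⱼ(X(j))` with `c > 0` (`IsStandardRep.exists_averagedResidual_eq`).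
The minimization therefore decouples. If slice `j` has samples, the third block of `Y(j)` is an
injective diagonal matrix, and linear least squares has a unique solution. If it has none, `Fⱼ = 0`,
and since `‖L X R‖ = ‖X‖` the secondary criterion selects `X = 0`.
-/

namespace TTALS

open MeasureTheory Set
open scoped Kronecker Pointwise

/-! ### Moments of the Euclidean unit ball -/

/-- The Euclidean unit ball of `ι → ℝ`.  The ambient type carries the sup norm, so this is not a
`Metric.closedBall`. -/
def unitBall (ι : Type*) [Fintype ι] : Set (ι → ℝ) := {y | ∑ i, y i ^ 2 ≤ 1}

/-- The reflection of `ι → ℝ` that changes the sign of the coordinates in `T`. -/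
def flip {ι : Type*} (T : ι → Prop) [DecidablePred T] (y : ι → ℝ) : ι → ℝ :=
  fun i => if T i then -y i else y i

lemma flip_flip {ι : Type*} (T : ι → Prop) [DecidablePred T] (y : ι → ℝ) :
    flip T (flip T y) = y := by
  ext i
  simp only [flip]
  split_ifs <;> simp

section Moments

variable {ι : Type*} [Fintype ι]

lemma isCompact_unitBall : IsCompact (unitBall ι) := by
  refine Metric.isCompact_of_isClosed_isBounded ?_ ?_
  · exact isClosed_le (by fun_prop) continuous_const
  · refine (Metric.isBounded_closedBall (x := (0 : ι → ℝ)) (r := 1)).subset fun y hy => ?_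
    rw [mem_closedBall_zero_iff, pi_norm_le_iff_of_nonneg zero_le_one]
    intro i
    have h1 : y i ^ 2 ≤ 1 :=
      (Finset.single_le_sum (f := fun i => y i ^ 2) (fun j _ => sq_nonneg _)
        (Finset.mem_univ i)).trans hy
    rw [Real.norm_eq_abs]
    exact (sq_le_one_iff_abs_le_one _).1 h1

lemma integrableOn_unitBall {g : (ι → ℝ) → ℝ} (hg : Continuous g) :
    IntegrableOn g (unitBall ι) :=
  hg.continuousOn.integrableOn_compact isCompact_unitBall

/-- The dilation `t • unitBall` is a sublevel set of `∑ yᵢ²`. -/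
lemma sqrt_smul_unitBall {t : ℝ} (ht : 0 < t) :
    √t • unitBall ι = {y | ∑ i, y i ^ 2 ≤ t} := by
  have hs : √t ≠ 0 := (Real.sqrt_pos.2 ht).ne'
  ext y
  rw [Set.mem_smul_set_iff_inv_smul_mem₀ hs]
  simp only [unitBall, mem_ofPred_eq, Pi.smul_apply, smul_eq_mul, mul_pow, inv_pow,
    Real.sq_sqrt ht.le, ← Finset.mul_sum]
  rw [inv_mul_le_iff₀ ht, mul_one]

/-- Dilating the unit ball multiplies the integral of a homogeneous function by a power. -/
lemma setIntegral_sublevel {p : (ι → ℝ) → ℝ} {d : ℕ}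
    (hp : ∀ (t : ℝ) (y : ι → ℝ), p (t • y) = t ^ d * p y) {t : ℝ} (ht : 0 < t) :
    ∫ y in {y : ι → ℝ | ∑ i, y i ^ 2 ≤ t}, p y =
      t ^ (((Fintype.card ι + d : ℕ) : ℝ) / 2) * ∫ y in unitBall ι, p y := by
  have hs : 0 < √t := Real.sqrt_pos.2 ht
  have h := Measure.setIntegral_comp_smul (volume : Measure (ι → ℝ)) p (unitBall ι) hs.ne'
  simp only [hp, Module.finrank_fintype_fun_eq_card, sqrt_smul_unitBall ht, smul_eq_mul,
    integral_const_mul] at h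
  rw [abs_of_pos (by positivity)] at h
  have h2 : t ^ (((Fintype.card ι + d : ℕ) : ℝ) / 2) = √t ^ (Fintype.card ι) * √t ^ d := by
    rw [← pow_add, Real.sqrt_eq_rpow, ← Real.rpow_mul_natCast ht.le]
    congr 1
    ring
  rw [h2, mul_assoc, h]
  field_simp

/-- Writing `e^{-|y|²}` as `∫_{|y|² ≤ t} e^{-t} dt` turns the Gaussian integral of a homogeneous
function into a Gamma factor times its integral over the unit ball. -/
lemma gaussian_integral_eq_Gamma_mul {p : (ι → ℝ) → ℝ} (hc : Continuous p) (h0 : ∀ y, 0 ≤ p y)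
    {d : ℕ} (hp : ∀ (t : ℝ) (y : ι → ℝ), p (t • y) = t ^ d * p y) :
    ∫ y : ι → ℝ, p y * Real.exp (-∑ i, y i ^ 2) =
      Real.Gamma (((Fintype.card ι + d : ℕ) : ℝ) / 2 + 1) * ∫ y in unitBall ι, p y := by
  set s : ℝ := ((Fintype.card ι + d : ℕ) : ℝ) / 2 with hs
  have hs0 : 0 ≤ s := by positivity
  have hM : 0 ≤ ∫ y in unitBall ι, p y := integral_nonneg h0
  have hΓ : 0 < Real.Gamma (s + 1) := Real.Gamma_pos_of_pos (by linarith)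
  have hexp : ∀ x : ℝ, ENNReal.ofReal (Real.exp (-x)) =
      ∫⁻ t in Ici x, ENNReal.ofReal (Real.exp (-t)) := by
    intro x
    rw [← restrict_Ioi_eq_restrict_Ici, ← integral_exp_neg_Ioi x,
      ofReal_integral_eq_lintegral_ofReal]
    · exact integrableOn_exp_neg_Ioi x
    · exact ae_of_all _ fun t => (Real.exp_pos _).le
  have hmeas : Measurable fun y : ι → ℝ => ∑ i, y i ^ 2 := by fun_prop
  have key : ∫⁻ y : ι → ℝ, ENNReal.ofReal (p y * Real.exp (-∑ i, y i ^ 2)) =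
      ENNReal.ofReal (Real.Gamma (s + 1) * ∫ y in unitBall ι, p y) := by
    calc ∫⁻ y : ι → ℝ, ENNReal.ofReal (p y * Real.exp (-∑ i, y i ^ 2))
        = ∫⁻ y : ι → ℝ, ∫⁻ t : ℝ, {z : (ι → ℝ) × ℝ | ∑ i, z.1 i ^ 2 ≤ z.2}.indicator
            (fun z => ENNReal.ofReal (p z.1) * ENNReal.ofReal (Real.exp (-z.2))) (y, t) := by
          refine lintegral_congr fun y => ?_
          rw [ENNReal.ofReal_mul (h0 y), hexp, ← lintegral_const_mul _ (by fun_prop),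
            ← lintegral_indicator measurableSet_Ici]
          rfl
      _ = ∫⁻ t : ℝ, ∫⁻ y : ι → ℝ, {z : (ι → ℝ) × ℝ | ∑ i, z.1 i ^ 2 ≤ z.2}.indicator
            (fun z => ENNReal.ofReal (p z.1) * ENNReal.ofReal (Real.exp (-z.2))) (y, t) := by
          refine lintegral_lintegral_swap ?_
          refine (Measurable.indicator ?_ ?_).aemeasurable
          · fun_prop
          · exact measurableSet_le (by fun_prop) (by fun_prop)
      _ = ∫⁻ t in Ioi (0 : ℝ), ENNReal.ofReal (Real.exp (-t) * t ^ (s + 1 - 1)) *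
            ENNReal.ofReal (∫ y in unitBall ι, p y) := by
          rw [← lintegral_indicator measurableSet_Ioi]
          refine lintegral_congr_ae ?_
          filter_upwards [Measure.ae_ne volume (0 : ℝ)] with t ht
          have hL : (∫⁻ y : ι → ℝ, {z : (ι → ℝ) × ℝ | ∑ i, z.1 i ^ 2 ≤ z.2}.indicator
              (fun z => ENNReal.ofReal (p z.1) * ENNReal.ofReal (Real.exp (-z.2))) (y, t)) =
              ∫⁻ y in {y : ι → ℝ | ∑ i, y i ^ 2 ≤ t},
                ENNReal.ofReal (p y) * ENNReal.ofReal (Real.exp (-t)) := by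
            rw [← lintegral_indicator (measurableSet_le hmeas measurable_const)]
            rfl
          rw [hL]
          rcases lt_or_gt_of_ne ht with h | h
          · have : {y : ι → ℝ | ∑ i, y i ^ 2 ≤ t} = ∅ := by
              ext y
              simp only [mem_ofPred_eq, mem_empty_iff_false, iff_false, not_le]
              exact h.trans_le (Finset.sum_nonneg fun i _ => sq_nonneg _)
            rw [this, indicator_of_notMem (by simpa using h.le)]
            simp
          · rw [indicator_of_mem (by simpa using h), lintegral_mul_const _ (by fun_prop),
              ← ofReal_integral_eq_lintegral_ofReal _ (ae_of_all _ h0), setIntegral_sublevel hp h,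
              mul_comm, ← ENNReal.ofReal_mul (by positivity), ← ENNReal.ofReal_mul (by positivity)]
            · simp only [add_sub_cancel_right, mul_assoc, hs]
            · have hcomp : IsCompact {y : ι → ℝ | ∑ i, y i ^ 2 ≤ t} := by
                rw [← sqrt_smul_unitBall h]
                exact isCompact_unitBall.smul _
              exact hc.continuousOn.integrableOn_compact hcomp
      _ = _ := by
          rw [lintegral_mul_const _ (by fun_prop), ENNReal.ofReal_mul hΓ.le,
            Real.Gamma_eq_integral (by linarith : 0 < s + 1),
            ofReal_integral_eq_lintegral_ofReal (Real.GammaIntegral_convergent (by linarith))]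
          refine (ae_restrict_iff' measurableSet_Ioi).2 (ae_of_all _ fun t ht => ?_)
          have : 0 < t := ht
          positivity
  rw [integral_eq_lintegral_of_nonneg_ae, key, ENNReal.toReal_ofReal (by positivity)]
  · exact ae_of_all _ fun y => mul_nonneg (h0 y) (Real.exp_pos _).le
  · fun_prop

lemma integral_sq_mul_exp_neg_sq :
    ∫ x : ℝ, x ^ 2 * Real.exp (-x ^ 2) = (1 / 2) * ∫ x : ℝ, Real.exp (-x ^ 2) := by
  have i0 : Integrable fun x : ℝ => Real.exp (-x ^ 2) := by
    simpa using integrable_exp_neg_mul_sq (b := 1) one_pos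
  have i1 : Integrable fun x : ℝ => x * Real.exp (-x ^ 2) := by
    simpa using integrable_mul_exp_neg_mul_sq (b := 1) one_pos
  have i2 : Integrable fun x : ℝ => x ^ 2 * Real.exp (-x ^ 2) := by
    have := integrable_rpow_mul_exp_neg_mul_sq (b := 1) one_pos (s := 2) (by norm_num)
    simpa using this
  have hd : ∀ x : ℝ, HasDerivAt (fun x : ℝ => x * Real.exp (-x ^ 2))
      (Real.exp (-x ^ 2) - 2 * (x ^ 2 * Real.exp (-x ^ 2))) x := by
    intro x
    have h := (hasDerivAt_id x).mul ((hasDerivAt_pow 2 x).neg.exp)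
    refine h.congr_deriv ?_
    simp only [id, Pi.neg_apply, Nat.cast_ofNat]
    ring
  have h := integral_eq_zero_of_hasDerivAt_of_integrable hd (i0.sub (i2.const_mul 2)) i1
  rw [integral_sub i0 (i2.const_mul 2), integral_const_mul] at h
  linarith

/-- The even moments of degree at most two in each variable, up to Gamma factors. -/
lemma Gamma_mul_moment [DecidableEq ι] (s : Finset ι) :
    Real.Gamma ((Fintype.card ι : ℝ) / 2 + s.card + 1) *
      ∫ y in unitBall ι, ∏ i ∈ s, y i ^ 2 =
    (1 / 2) ^ s.card * (∫ x : ℝ, Real.exp (-x ^ 2)) ^ Fintype.card ι := by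
  have h := gaussian_integral_eq_Gamma_mul (p := fun y : ι → ℝ => ∏ i ∈ s, y i ^ 2)
    (by fun_prop) (fun y => Finset.prod_nonneg fun i _ => sq_nonneg _) (d := 2 * s.card) (by
      intro t y
      simp only [Pi.smul_apply, smul_eq_mul, mul_pow, Finset.prod_mul_distrib,
        Finset.prod_const, ← pow_mul])
  have e : ((Fintype.card ι + 2 * s.card : ℕ) : ℝ) / 2 + 1 =
      (Fintype.card ι : ℝ) / 2 + s.card + 1 := by
    push_cast; ring
  rw [e] at h
  rw [← h]
  have hprod : ∀ y : ι → ℝ, (∏ i ∈ s, y i ^ 2) * Real.exp (-∑ i, y i ^ 2) =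
      ∏ i, (fun x : ℝ => (if i ∈ s then x ^ 2 else 1) * Real.exp (-x ^ 2)) (y i) := by
    intro y
    simp only [Finset.prod_mul_distrib, ← Real.exp_sum, Finset.sum_neg_distrib]
    congr 1
    rw [Finset.prod_ite_mem, Finset.univ_inter]
  simp_rw [hprod]
  rw [integral_fintype_prod_volume_eq_prod
    (fun i => fun x : ℝ => (if i ∈ s then x ^ 2 else 1) * Real.exp (-x ^ 2))]
  have hfac : ∀ i, ∫ x : ℝ, (if i ∈ s then x ^ 2 else 1) * Real.exp (-x ^ 2) =
      (if i ∈ s then 1 / 2 else 1) * ∫ x : ℝ, Real.exp (-x ^ 2) := by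
    intro i
    split_ifs
    · exact integral_sq_mul_exp_neg_sq
    · simp
  simp only [hfac, Finset.prod_mul_distrib, Finset.prod_ite_mem, Finset.univ_inter,
    Finset.prod_const, Finset.card_univ]

/-- The volume of the Euclidean unit ball of `ι → ℝ`. -/
noncomputable def ballVolume (ι : Type*) [Fintype ι] : ℝ := ∫ _y in unitBall ι, (1 : ℝ)

lemma ballVolume_pos : 0 < ballVolume ι := by
  classical
  have h := Gamma_mul_moment (∅ : Finset ι)
  simp only [Finset.card_empty, Finset.prod_empty, pow_zero, one_mul, Nat.cast_zero,
    add_zero] at h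
  have hg : 0 < ∫ x : ℝ, Real.exp (-x ^ 2) := by
    have := integral_gaussian 1
    simp only [neg_mul, one_mul, div_one] at this
    rw [this]
    exact Real.sqrt_pos.2 Real.pi_pos
  have hΓ : 0 < Real.Gamma ((Fintype.card ι : ℝ) / 2 + 1) :=
    Real.Gamma_pos_of_pos (by positivity)
  have hpos := pow_pos hg (Fintype.card ι)
  rw [← h] at hpos
  exact (pos_iff_pos_of_mul_pos hpos).1 hΓ

/-- `∫ yᵢ² = vol / (D + 2)`. -/
lemma integral_unitBall_sq (i : ι) :
    ∫ y in unitBall ι, y i ^ 2 = ballVolume ι / ((Fintype.card ι : ℝ) + 2) := by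
  classical
  have h0 := Gamma_mul_moment (∅ : Finset ι)
  have h1 := Gamma_mul_moment ({i} : Finset ι)
  simp only [Finset.card_empty, Finset.prod_empty, pow_zero, one_mul, Nat.cast_zero,
    add_zero] at h0
  simp only [Finset.card_singleton, Finset.prod_singleton, pow_one, Nat.cast_one] at h1
  rw [← h0, Real.Gamma_add_one (by positivity)] at h1
  have hΓ : 0 < Real.Gamma ((Fintype.card ι : ℝ) / 2 + 1) :=
    Real.Gamma_pos_of_pos (by positivity)
  rw [eq_div_iff (by positivity), ballVolume]
  refine mul_left_cancel₀ hΓ.ne' ?_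
  linear_combination 2 * h1

/-- `∫ yᵢ² yₖ² = vol / ((D + 2) (D + 4))` for `i ≠ k`. -/
lemma integral_unitBall_sq_mul_sq {i k : ι} (hik : i ≠ k) :
    ∫ y in unitBall ι, y i ^ 2 * y k ^ 2 =
      ballVolume ι / (((Fintype.card ι : ℝ) + 2) * ((Fintype.card ι : ℝ) + 4)) := by
  classical
  have h0 := Gamma_mul_moment (∅ : Finset ι)
  have h1 := Gamma_mul_moment ({i, k} : Finset ι)
  simp only [Finset.card_empty, Finset.prod_empty, pow_zero, one_mul, Nat.cast_zero,
    add_zero] at h0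
  simp only [Finset.card_pair hik, Finset.prod_pair hik, Nat.cast_ofNat] at h1
  have e : (Fintype.card ι : ℝ) / 2 + 2 + 1 = ((Fintype.card ι : ℝ) / 2 + 1) + 1 + 1 := by ring
  rw [← h0, e, Real.Gamma_add_one (by positivity), Real.Gamma_add_one (by positivity)] at h1
  have hΓ : 0 < Real.Gamma ((Fintype.card ι : ℝ) / 2 + 1) :=
    Real.Gamma_pos_of_pos (by positivity)
  rw [eq_div_iff (by positivity), ballVolume]
  refine mul_left_cancel₀ hΓ.ne' ?_
  linear_combination 4 * h1

/-- Parity: a function that changes sign under a coordinate reflection integrates to zero. -/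
lemma integral_unitBall_eq_zero_of_flip (T : ι → Prop) [DecidablePred T] {g : (ι → ℝ) → ℝ}
    (hg : ∀ y, g (flip T y) = -g y) : ∫ y in unitBall ι, g y = 0 := by
  have hmp : MeasurePreserving (flip T) (volume : Measure (ι → ℝ)) volume := by
    refine volume_preserving_pi (f := fun i x => if T i then -x else x) fun i => ?_
    by_cases h : T i
    · simpa [h] using Measure.measurePreserving_neg (volume : Measure ℝ)
    · simp only [h, if_false]
      exact MeasurePreserving.id (volume : Measure ℝ)
  have hemb : MeasurableEmbedding (flip T : (ι → ℝ) → ι → ℝ) :=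
    (MeasurableEquiv.mk ⟨flip T, flip T, flip_flip T, flip_flip T⟩ hmp.measurable
      hmp.measurable).measurableEmbedding
  have hpre : flip T ⁻¹' unitBall ι = unitBall ι := by
    ext y
    have : ∀ i, flip T y i ^ 2 = y i ^ 2 := by
      intro i
      simp only [flip]
      split_ifs <;> ring
    simp only [unitBall, mem_preimage, mem_ofPred_eq, this]
  have h := hmp.setIntegral_preimage_emb hemb g (unitBall ι)
  simp only [hpre, hg, integral_neg] at h
  linarith

end Moments

/-! ### Averages of squared trilinear residuals -/

section Parity

variable {ι : Type*} [Fintype ι]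

/-- The integral over the unit ball of the square of a combination of orthogonal functions with
equal norms. -/
lemma integral_sq_sum_of_orthogonal {κ : Type*} [Fintype κ] {m : κ → (ι → ℝ) → ℝ}
    (hm : ∀ p, Continuous (m p)) {M : ℝ} (hd : ∀ p, ∫ y in unitBall ι, m p y ^ 2 = M)
    (ho : ∀ p p', p ≠ p' → ∫ y in unitBall ι, m p y * m p' y = 0) (c : κ → ℝ) :
    ∫ y in unitBall ι, (∑ p, c p * m p y) ^ 2 = M * ∑ p, c p ^ 2 := by
  classical
  have h : ∀ y, (∑ p, c p * m p y) ^ 2 = ∑ p, ∑ p', c p * c p' * (m p y * m p' y) := by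
    intro y
    rw [sq, Finset.sum_mul_sum]
    exact Finset.sum_congr rfl fun p _ => Finset.sum_congr rfl fun p' _ => by ring
  simp_rw [h]
  rw [integral_finsetSum _ fun p _ => integrableOn_unitBall (by fun_prop), Finset.mul_sum]
  refine Finset.sum_congr rfl fun p _ => ?_
  rw [integral_finsetSum _ fun p' _ => integrableOn_unitBall (by fun_prop)]
  simp_rw [integral_const_mul]
  rw [Finset.sum_eq_single p]
  · simp_rw [← sq, hd]
    ring
  · intro p' _ hp
    rw [ho p p' hp.symm, mul_zero]
  · simp

lemma integral_sq_linear {κ : Type*} [Fintype κ] {f : κ → ι} (hf : Function.Injective f)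
    (c : κ → ℝ) :
    ∫ y in unitBall ι, (∑ p, c p * y (f p)) ^ 2 =
      ballVolume ι / ((Fintype.card ι : ℝ) + 2) * ∑ p, c p ^ 2 := by
  classical
  refine integral_sq_sum_of_orthogonal (m := fun p y => y (f p)) (fun p => by fun_prop)
    (fun p => integral_unitBall_sq _) (fun p p' h => ?_) c
  refine integral_unitBall_eq_zero_of_flip (· = f p) fun y => ?_
  simp [flip, hf.ne h.symm]

lemma integral_sq_bilinear {κ μ : Type*} [Fintype κ] [Fintype μ] {f : κ → ι} {g : μ → ι}
    (hf : Function.Injective f) (hg : Function.Injective g) (hfg : ∀ i k, f i ≠ g k)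
    (c : κ → μ → ℝ) :
    ∫ y in unitBall ι, (∑ i, ∑ k, c i k * (y (f i) * y (g k))) ^ 2 =
      ballVolume ι / (((Fintype.card ι : ℝ) + 2) * ((Fintype.card ι : ℝ) + 4)) *
        ∑ i, ∑ k, c i k ^ 2 := by
  classical
  have h := integral_sq_sum_of_orthogonal (ι := ι) (κ := κ × μ)
    (m := fun p y => y (f p.1) * y (g p.2)) (fun p => by fun_prop)
    (fun p => by simpa only [mul_pow] using integral_unitBall_sq_mul_sq (hfg p.1 p.2))
    (fun p p' h => ?_) (fun p => c p.1 p.2)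
  · simpa only [Fintype.sum_prod_type] using h
  by_cases h1 : p.1 = p'.1
  · have h2 : p.2 ≠ p'.2 := fun h2 => h (Prod.ext h1 h2)
    refine integral_unitBall_eq_zero_of_flip (· = g p.2) fun y => ?_
    simp [flip, hg.ne h2.symm, hfg]
  · refine integral_unitBall_eq_zero_of_flip (· = f p.1) fun y => ?_
    simp [flip, hf.ne (Ne.symm h1), (hfg _ _).symm]

/-- If the parities of the terms under three reflections are pairwise different, the integral of
the square of their sum has no cross terms. -/
lemma integral_sq_of_parity (TL TN TR : ι → Prop) [DecidablePred TL] [DecidablePred TN]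
    [DecidablePred TR] (c : ℝ) {f g h n : (ι → ℝ) → ℝ} (hf : Continuous f) (hg : Continuous g)
    (hh : Continuous h) (hn : Continuous n)
    (fL : ∀ y, f (flip TL y) = -f y) (fN : ∀ y, f (flip TN y) = f y)
    (fR : ∀ y, f (flip TR y) = f y) (gL : ∀ y, g (flip TL y) = g y)
    (gN : ∀ y, g (flip TN y) = g y) (gR : ∀ y, g (flip TR y) = -g y)
    (hL : ∀ y, h (flip TL y) = -h y) (hN : ∀ y, h (flip TN y) = h y)
    (hR : ∀ y, h (flip TR y) = -h y) (nN : ∀ y, n (flip TN y) = -n y) :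
    ∫ y in unitBall ι, (c + f y + g y + h y + n y) ^ 2 =
      ballVolume ι * c ^ 2 + (∫ y in unitBall ι, f y ^ 2) + (∫ y in unitBall ι, g y ^ 2) +
        (∫ y in unitBall ι, h y ^ 2) + ∫ y in unitBall ι, n y ^ 2 := by
  have e1 := integral_unitBall_eq_zero_of_flip TL (g := fun y => (c + g y) * (f y + h y))
    fun y => by rw [fL, gL, hL]; ring
  have e2 := integral_unitBall_eq_zero_of_flip TR (g := fun y => c * g y + f y * h y)
    fun y => by rw [fR, gR, hR]; ring
  have e3 := integral_unitBall_eq_zero_of_flip TN (g := fun y => n y * (c + f y + g y + h y))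
    fun y => by rw [fN, gN, hN, nN]; ring
  have hexp : ∀ y, (c + f y + g y + h y + n y) ^ 2 =
      c ^ 2 * 1 + f y ^ 2 + g y ^ 2 + h y ^ 2 + n y ^ 2 +
        2 * ((c + g y) * (f y + h y)) + 2 * (c * g y + f y * h y) +
        2 * (n y * (c + f y + g y + h y)) := fun y => by ring
  simp_rw [hexp]
  have I : ∀ {k : (ι → ℝ) → ℝ}, Continuous k → Integrable k (volume.restrict (unitBall ι)) :=
    fun hk => integrableOn_unitBall hk
  rw [integral_add (I (by fun_prop)) (I (by fun_prop)),
    integral_add (I (by fun_prop)) (I (by fun_prop)),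
    integral_add (I (by fun_prop)) (I (by fun_prop)),
    integral_add (I (by fun_prop)) (I (by fun_prop)),
    integral_add (I (by fun_prop)) (I (by fun_prop)),
    integral_add (I (by fun_prop)) (I (by fun_prop)),
    integral_add (I (by fun_prop)) (I (by fun_prop)),
    integral_const_mul, integral_const_mul, integral_const_mul, integral_const_mul, e1, e2, e3,
    ballVolume]
  ring

end Parity

/-- The average over the unit ball of the squared residual of one entry.  Up to a constant it is
the squared residual at the center plus a quadratic form in the middle factor `X`. -/
theorem integral_sq_entry {α β γ κ μ : Type*} [Fintype α] [Fintype β] [Fintype γ] [Fintype κ]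
    [Fintype μ] {iL : κ → α} (hiL : Function.Injective iL) (iN : κ → μ → β) {iR : μ → γ}
    (hiR : Function.Injective iR) (a u : κ → ℝ) (r v : μ → ℝ) (w b : ℝ) :
    ∃ C : ℝ, ∀ X : κ → μ → ℝ,
      ∫ y in unitBall (α ⊕ β ⊕ γ), ((∑ i, ∑ k, (a i + u i * y (.inl (iL i))) *
        (X i k + w * y (.inr (.inl (iN i k)))) * (r k + v k * y (.inr (.inr (iR k))))) - b) ^ 2 =
      C + ballVolume (α ⊕ β ⊕ γ) * (((∑ i, ∑ k, a i * X i k * r k) - b) ^ 2 +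
        (∑ i, (u i * ∑ k, X i k * r k) ^ 2) / ((Fintype.card (α ⊕ β ⊕ γ) : ℝ) + 2) +
        (∑ k, (v k * ∑ i, a i * X i k) ^ 2) / ((Fintype.card (α ⊕ β ⊕ γ) : ℝ) + 2) +
        (∑ i, ∑ k, (u i * v k * X i k) ^ 2) / (((Fintype.card (α ⊕ β ⊕ γ) : ℝ) + 2) *
          ((Fintype.card (α ⊕ β ⊕ γ) : ℝ) + 4))) := by
  classical
  -- The part containing the variation of the middle factor does not depend on `X`.
  set n : (α ⊕ β ⊕ γ → ℝ) → ℝ := fun y => ∑ i, ∑ k, (a i + u i * y (.inl (iL i))) *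
    (w * y (.inr (.inl (iN i k)))) * (r k + v k * y (.inr (.inr (iR k)))) with hn
  refine ⟨∫ y in unitBall (α ⊕ β ⊕ γ), n y ^ 2, fun X => ?_⟩
  have hsplit : ∀ y : α ⊕ β ⊕ γ → ℝ, (∑ i, ∑ k, (a i + u i * y (.inl (iL i))) *
        (X i k + w * y (.inr (.inl (iN i k)))) * (r k + v k * y (.inr (.inr (iR k))))) - b =
      ((∑ i, ∑ k, a i * X i k * r k) - b) +
        (∑ i, (u i * ∑ k, X i k * r k) * y (.inl (iL i))) +
        (∑ k, (v k * ∑ i, a i * X i k) * y (.inr (.inr (iR k)))) +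
        (∑ i, ∑ k, (u i * v k * X i k) * (y (.inl (iL i)) * y (.inr (.inr (iR k))))) + n y := by
    intro y
    have h1 : ∑ i, (u i * ∑ k, X i k * r k) * y (.inl (iL i)) =
        ∑ i, ∑ k, (u i * (X i k * r k)) * y (.inl (iL i)) := by
      simp only [Finset.mul_sum, Finset.sum_mul]
    have h2 : ∑ k, (v k * ∑ i, a i * X i k) * y (.inr (.inr (iR k))) =
        ∑ i, ∑ k, (v k * (a i * X i k)) * y (.inr (.inr (iR k))) := by
      simp only [Finset.mul_sum, Finset.sum_mul]
      exact Finset.sum_comm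
    have h3 : ∀ s t x z m b : ℝ, s - b + x + t + z + m = s + x + t + z + m - b := by
      intros; ring
    rw [h1, h2, hn, h3]
    congr 1
    simp only [← Finset.sum_add_distrib]
    exact Finset.sum_congr rfl fun i _ => Finset.sum_congr rfl fun k _ => by ring
  simp_rw [hsplit]
  rw [integral_sq_of_parity (fun s => s.isLeft = true) (fun s => ∃ t, s = .inr (.inl t))
    (fun s => ∃ t, s = .inr (.inr t))]
  rotate_left
  all_goals try fun_prop
  all_goals try (intro y; simp [flip, hn, ← Finset.sum_neg_distrib])
  rw [integral_sq_linear (f := fun i => (.inl (iL i) : α ⊕ β ⊕ γ))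
      (Sum.inl_injective.comp hiL),
    integral_sq_linear (f := fun k => (.inr (.inr (iR k)) : α ⊕ β ⊕ γ))
      (Sum.inr_injective.comp (Sum.inr_injective.comp hiR)),
    integral_sq_bilinear (f := fun i => (.inl (iL i) : α ⊕ β ⊕ γ))
      (g := fun k => (.inr (.inr (iR k)) : α ⊕ β ⊕ γ)) (Sum.inl_injective.comp hiL)
      (Sum.inr_injective.comp (Sum.inr_injective.comp hiR)) (by simp)]
  ring

/-! ### Frobenius norms and standard representations -/

section Frobenius

variable {m n k : Type*} [Fintype m] [Fintype n] [Fintype k]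

lemma frobSq_transpose (X : Matrix m n ℝ) : frobSq X.transpose = frobSq X :=
  Finset.sum_comm

lemma frobSq_eq_trace (X : Matrix m n ℝ) : frobSq X = (X.transpose * X).trace := by
  rw [← frobSq_transpose]
  simp [frobSq, Matrix.trace, Matrix.mul_apply, sq]

lemma frobSq_mul_left [DecidableEq n] {U : Matrix m n ℝ} (hU : U.transpose * U = 1)
    (X : Matrix n k ℝ) : frobSq (U * X) = frobSq X := by
  rw [frobSq_eq_trace, frobSq_eq_trace, Matrix.transpose_mul, Matrix.mul_assoc,
    ← Matrix.mul_assoc U.transpose, hU, Matrix.one_mul]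

lemma frobSq_mul_right [DecidableEq n] {W : Matrix n k ℝ} (hW : W * W.transpose = 1)
    (X : Matrix m n ℝ) : frobSq (X * W) = frobSq X := by
  rw [← frobSq_transpose, Matrix.transpose_mul, frobSq_mul_left (by simpa using hW),
    frobSq_transpose]

lemma coreFrobSq_eq_rightUnfold {n k₁ k₂ : ℕ} (H : Core n k₁ k₂) :
    coreFrobSq H = frobSq (rightUnfold H) := by
  simp only [coreFrobSq, frobSq, rightUnfold, Matrix.of_apply, Fintype.sum_prod_type]
  rw [Finset.sum_comm]
  exact Finset.sum_congr rfl fun _ _ => Finset.sum_comm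

lemma coreFrobSq_eq_leftUnfold {n k₁ k₂ : ℕ} (H : Core n k₁ k₂) :
    coreFrobSq H = frobSq (leftUnfold H) := by
  simp only [coreFrobSq, frobSq, leftUnfold, Matrix.of_apply, Fintype.sum_prod_type]
  rw [Finset.sum_comm]

end Frobenius

section StandardRep

variable {nL nN nR rL rR : ℕ} {A : Core nN nL nR} {L : Matrix (Fin nL) (Fin rL) ℝ}
  {σL : Fin rL → ℝ} {N : Core nN rL rR} {σR : Fin rR → ℝ} {R : Matrix (Fin rR) (Fin nR) ℝ}

lemma IsStandardRep.frobSq_mul_mul (hA : IsStandardRep A L σL N σR R)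
    (X : Matrix (Fin rL) (Fin rR) ℝ) : frobSq (L * X * R) = frobSq X := by
  rw [frobSq_mul_right hA.svd_right.row_orthogonal, frobSq_mul_left hA.svd_left.col_orthogonal]

lemma IsStandardRep.coreFrobSq_tau (hA : IsStandardRep A L σL N σR R) (X : Core nN rL rR) :
    coreFrobSq (tau L X R) = coreFrobSq X :=
  Finset.sum_congr rfl fun _ _ => hA.frobSq_mul_mul _

lemma IsStandardRep.coreFrobSq_tau_left (hA : IsStandardRep A L σL N σR R)
    (ΔL : Matrix (Fin nL) (Fin rL) ℝ) :
    coreFrobSq (tau ΔL (scaledCore σL N σR) R) = ∑ a, ∑ l, (σL l * ΔL a l) ^ 2 := by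
  have h : rightUnfold (tau ΔL (scaledCore σL N σR) R) =
      (ΔL * Matrix.diagonal σL) * rightUnfold fun j => N j * Matrix.diagonal σR * R := by
    ext a p
    have h1 : tau ΔL (scaledCore σL N σR) R p.2 =
        (ΔL * Matrix.diagonal σL) * (N p.2 * Matrix.diagonal σR * R) := by
      simp only [tau, scaledCore, Matrix.mul_assoc]
    simp only [rightUnfold, Matrix.of_apply, h1, Matrix.mul_apply (M := ΔL * Matrix.diagonal σL)]
  rw [coreFrobSq_eq_rightUnfold, h, frobSq_mul_right hA.svd_left.row_orthogonal]
  simp only [frobSq, Matrix.mul_diagonal, mul_comm (σL _)]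

lemma IsStandardRep.coreFrobSq_tau_right (hA : IsStandardRep A L σL N σR R)
    (ΔR : Matrix (Fin rR) (Fin nR) ℝ) :
    coreFrobSq (tau L (scaledCore σL N σR) ΔR) = ∑ q, ∑ b, (σR q * ΔR q b) ^ 2 := by
  have h : leftUnfold (tau L (scaledCore σL N σR) ΔR) =
      (leftUnfold fun j => L * Matrix.diagonal σL * N j) * (Matrix.diagonal σR * ΔR) := by
    ext p b
    have h1 : tau L (scaledCore σL N σR) ΔR p.2 =
        (L * Matrix.diagonal σL * N p.2) * (Matrix.diagonal σR * ΔR) := by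
      simp only [tau, scaledCore, Matrix.mul_assoc]
    simp only [leftUnfold, Matrix.of_apply, h1,
      Matrix.mul_apply (N := Matrix.diagonal σR * ΔR)]
  rw [coreFrobSq_eq_leftUnfold, h, frobSq_mul_left hA.svd_right.col_orthogonal]
  simp only [frobSq, Matrix.diagonal_mul]

end StandardRep

/-! ### Change of coordinates on the space of variations -/

section Coordinates

/-- Index set of all the entries of a variation. -/
abbrev VariationIndex (nL nN nR rL rR : ℕ) : Type :=
  (Fin nL × Fin rL) ⊕ (Fin nN × Fin rL × Fin rR) ⊕ (Fin rR × Fin nR)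

lemma card_variationIndex (nL nN nR rL rR : ℕ) :
    Fintype.card (VariationIndex nL nN nR rL rR) = totalSize nL nN nR rL rR := by
  simp only [Fintype.card_sum, Fintype.card_prod, Fintype.card_fin, totalSize]
  ring

variable {nL nN nR rL rR : ℕ}

/-- Rescaled coordinates on the space of variations, in which the variation set of a standard
representation with singular values `σL`, `σR` is the Euclidean unit ball. -/
noncomputable def scaledCoords {ω : ℝ} (hω : ω ≠ 0) {σL : Fin rL → ℝ} (hL : ∀ l, σL l ≠ 0)
    {σR : Fin rR → ℝ} (hR : ∀ q, σR q ≠ 0) :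
    Variation nL nN nR rL rR ≃ₗ[ℝ] (VariationIndex nL nN nR rL rR → ℝ) where
  toFun δ := Sum.elim (fun p => σL p.2 * δ.1 p.1 p.2 / ω)
    (Sum.elim (fun p => δ.2.1 p.1 p.2.1 p.2.2 / ω) fun p => σR p.1 * δ.2.2 p.1 p.2 / ω)
  invFun y := (fun a l => ω / σL l * y (.inl (a, l)),
    fun j l q => ω * y (.inr (.inl (j, l, q))), fun q b => ω / σR q * y (.inr (.inr (q, b))))
  map_add' δ δ' := by
    ext (p | p | p) <;> simp <;> ring
  map_smul' t δ := by
    ext (p | p | p) <;> simp <;> ring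
  left_inv δ := by
    refine Prod.ext ?_ (Prod.ext ?_ ?_)
    · ext a l
      have := hL l
      simp
      field_simp
    · ext j l q
      simp
      field_simp
    · ext q b
      have := hR q
      simp
      field_simp
  right_inv y := by
    ext (p | p | p)
    · have := hL p.2
      simp
      field_simp
    · simp
      field_simp
    · have := hR p.1
      simp
      field_simp

lemma IsStandardRep.variationSet_eq {A : Core nN nL nR} {L : Matrix (Fin nL) (Fin rL) ℝ}
    {σL : Fin rL → ℝ} {N : Core nN rL rR} {σR : Fin rR → ℝ} {R : Matrix (Fin rR) (Fin nR) ℝ}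
    (hA : IsStandardRep A L σL N σR R) {ω : ℝ} (hω : ω ≠ 0) (hL : ∀ l, σL l ≠ 0)
    (hR : ∀ q, σR q ≠ 0) :
    variationSet ω L (scaledCore σL N σR) R =
      scaledCoords (nL := nL) (nN := nN) (nR := nR) hω hL hR ⁻¹' unitBall _ := by
  ext δ
  have hω2 : 0 < ω ^ 2 := by positivity
  simp only [variationSet, unitBall, mem_preimage, mem_ofPred_eq, hA.coreFrobSq_tau_left,
    hA.coreFrobSq_tau, hA.coreFrobSq_tau_right, scaledCoords, LinearEquiv.coe_mk,
    LinearMap.coe_mk, AddHom.coe_mk, Fintype.sum_sum_type, Sum.elim_inl, Sum.elim_inr,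
    Fintype.sum_prod_type, div_pow, ← Finset.sum_div, ← add_div]
  rw [div_le_one hω2, ← add_assoc]
  rfl

/-- A linear change of coordinates multiplies integrals by a positive constant. -/
lemma exists_setIntegral_eq_smul {ι E : Type*} [Fintype ι] [NormedAddCommGroup E]
    [NormedSpace ℝ E] [FiniteDimensional ℝ E] [MeasurableSpace E] [BorelSpace E] (μ : Measure E)
    [μ.IsAddHaarMeasure] (e : E ≃ₗ[ℝ] (ι → ℝ)) (K : Set (ι → ℝ)) :
    ∃ c : ℝ, 0 < c ∧ ∀ g : E → ℝ, ∫ x in e ⁻¹' K, g x ∂μ = c * ∫ y in K, g (e.symm y) := by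
  let f := e.symm.toContinuousLinearEquiv
  have hf : (Measure.map f (volume : Measure (ι → ℝ))).IsAddHaarMeasure :=
    f.isAddHaarMeasure_map _
  set ν := Measure.map f (volume : Measure (ι → ℝ)) with hν
  have h := Measure.isAddLeftInvariant_eq_smul μ ν
  have hc := Measure.addHaarScalarFactor_pos_of_isAddHaarMeasure μ ν
  refine ⟨μ.addHaarScalarFactor ν, by exact_mod_cast hc, fun g => ?_⟩
  conv_lhs => rw [h]
  rw [Measure.restrict_smul, integral_smul_nnreal_measure, NNReal.smul_def, smul_eq_mul]
  congr 1
  have h2 := setIntegral_map_equiv (μ := (volume : Measure (ι → ℝ)))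
    f.toHomeomorph.toMeasurableEquiv g (e ⁻¹' K)
  have h3 : f.toHomeomorph.toMeasurableEquiv ⁻¹' (e ⁻¹' K) = K := by
    ext y
    change e (e.symm y) ∈ K ↔ _
    rw [e.apply_symm_apply]
  rw [h3] at h2
  exact h2

/-- The instance search does not reach this product of iterated `Pi` types. -/
lemma isAddHaarMeasure_volume_variation :
    (volume : Measure (Variation nL nN nR rL rR)).IsAddHaarMeasure := by
  have h1 : ∀ a : ℕ, (volume : Measure (Fin a → ℝ)).IsAddHaarMeasure := fun _ =>
    Measure.pi.isAddHaarMeasure _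
  have h2 : ∀ a b : ℕ, (volume : Measure (Fin a → Fin b → ℝ)).IsAddHaarMeasure := fun _ _ =>
    Measure.pi.isAddHaarMeasure _
  have h3 : ∀ a b c : ℕ, (volume : Measure (Fin a → Fin b → Fin c → ℝ)).IsAddHaarMeasure :=
    fun _ _ _ => Measure.pi.isAddHaarMeasure _
  have h4 : MeasurableAdd ((Fin nN → Fin rL → Fin rR → ℝ) × (Fin rR → Fin nR → ℝ)) :=
    ContinuousAdd.measurableAdd
  have h5 := Measure.prod.instIsAddHaarMeasure
    (volume : Measure (Fin nN → Fin rL → Fin rR → ℝ)) (volume : Measure (Fin rR → Fin nR → ℝ))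
  exact Measure.prod.instIsAddHaarMeasure _ _

end Coordinates

/-! ### The averaged residual as a sum of slice objectives -/

section Objective

variable {nL nN nR rL rR : ℕ} {A : Core nN nL nR} {L : Matrix (Fin nL) (Fin rL) ℝ}
  {σL : Fin rL → ℝ} {N : Core nN rL rR} {σR : Fin rR → ℝ} {R : Matrix (Fin rR) (Fin nR) ℝ}

lemma sum_slice (S : Finset (Fin nL × Fin nN × Fin nR)) (f : Fin nL → Fin nN → Fin nR → ℝ) :
    ∑ p ∈ S, f p.1 p.2.1 p.2.2 = ∑ j, ∑ p ∈ slice S j, f p.1 j p.2 := by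
  have h1 : ∑ p ∈ S, f p.1 p.2.1 p.2.2 =
      ∑ p : Fin nL × Fin nN × Fin nR, if p ∈ S then f p.1 p.2.1 p.2.2 else 0 := by
    simp
  have h2 : ∀ j, ∑ p ∈ slice S j, f p.1 j p.2 =
      ∑ p : Fin nL × Fin nR, if (p.1, j, p.2) ∈ S then f p.1 j p.2 else 0 := by
    intro j
    rw [slice, Finset.sum_filter]
  rw [h1]
  simp only [h2, Fintype.sum_prod_type]
  exact Finset.sum_comm

lemma variedResidual_eq (γL γR : ℝ) (B : Core nN nL nR)
    (S : Finset (Fin nL × Fin nN × Fin nR)) (X : Core nN rL rR)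
    (δ : Variation nL nN nR rL rR) :
    variedResidual γL γR B S L R X δ = ∑ p ∈ S, ((∑ l, ∑ q,
      (L p.1 l + γL * δ.1 p.1 l) * (X p.2.1 l q + δ.2.1 p.2.1 l q) *
        (R q p.2.2 + γR * δ.2.2 q p.2.2)) - B p.2.1 p.1 p.2.2) ^ 2 := by
  refine Finset.sum_congr rfl fun p _ => ?_
  congr 1
  simp only [Pi.sub_apply, Matrix.sub_apply, tau, Matrix.mul_apply, Finset.sum_mul]
  rw [Finset.sum_comm]
  rfl

lemma continuous_variedResidual (γL γR : ℝ) (B : Core nN nL nR)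
    (S : Finset (Fin nL × Fin nN × Fin nR)) (X : Core nN rL rR) :
    Continuous (variedResidual γL γR B S L R X) := by
  simp_rw [funext (variedResidual_eq (L := L) (R := R) γL γR B S X)]
  fun_prop

lemma IsStandardRep.integrableOn_variedResidual (hA : IsStandardRep A L σL N σR R) {ω : ℝ}
    (hω : 0 < ω) (γL γR : ℝ) (B : Core nN nL nR) (S : Finset (Fin nL × Fin nN × Fin nR))
    (X : Core nN rL rR) :
    IntegrableOn (variedResidual γL γR B S L R X)
      (variationSet ω L (scaledCore σL N σR) R) := by
  have := isAddHaarMeasure_volume_variation (nL := nL) (nN := nN) (nR := nR) (rL := rL) (rR := rR)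
  refine (continuous_variedResidual γL γR B S X).continuousOn.integrableOn_compact ?_
  have hL : ∀ l, σL l ≠ 0 := fun l => (hA.svd_left.pos l).ne'
  have hR : ∀ q, σR q ≠ 0 := fun q => (hA.svd_right.pos q).ne'
  rw [hA.variationSet_eq hω.ne' hL hR]
  exact (scaledCoords hω.ne' hL hR).toContinuousLinearEquiv.toHomeomorph.isCompact_preimage.2
    isCompact_unitBall

lemma inv_diagonal_of_ne_zero {n : Type*} [Fintype n] [DecidableEq n] {σ : n → ℝ}
    (h : ∀ i, σ i ≠ 0) : (Matrix.diagonal σ)⁻¹ = Matrix.diagonal fun i => (σ i)⁻¹ := by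
  refine Matrix.inv_eq_right_inv ?_
  rw [Matrix.diagonal_mul_diagonal, ← Matrix.diagonal_one]
  congr 1
  ext i
  exact mul_inv_cancel₀ (h i)

/-- The regularizer of slice `j`, written block by block. -/
lemma sum_regMatrix_mulVec_sq (ω γL γR : ℝ) (S : Finset (Fin nL × Fin nN × Fin nR))
    (hL : ∀ l, σL l ≠ 0) (hR : ∀ q, σR q ≠ 0) (j : Fin nN) (X : Matrix (Fin rL) (Fin rR) ℝ) :
    ∑ i, ((regMatrix ω γL γR S L σL σR R j).mulVec X.vec) i ^ 2 =
      √((nL : ℝ)⁻¹ * zeta₁ nL nN nR rL rR ω γL) ^ 2 *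
        (∑ p ∈ slice S j, ∑ l, ((σL l)⁻¹ * ∑ q, X l q * R q p.2) ^ 2) +
      √((nR : ℝ)⁻¹ * zeta₂ nL nN nR rL rR ω γR) ^ 2 *
        (∑ p ∈ slice S j, ∑ q, ((σR q)⁻¹ * ∑ l, L p.1 l * X l q) ^ 2) +
      √(rho₁₂ S j * zeta₁₂ nL nN nR rL rR ω γL γR) ^ 2 *
        ∑ l, ∑ q, ((σL l)⁻¹ * (σR q)⁻¹ * X l q) ^ 2 := by
  simp only [regMatrix, Matrix.fromRows_mulVec, Fintype.sum_sum_type, Sum.elim_inl, Sum.elim_inr,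
    Matrix.smul_mulVec, Matrix.kronecker_mulVec_vec, Pi.smul_apply, smul_eq_mul, mul_pow,
    ← Finset.mul_sum, inv_diagonal_of_ne_zero hL, inv_diagonal_of_ne_zero hR,
    Matrix.diagonal_transpose, Matrix.transpose_transpose, ← add_assoc]
  congr 1
  · congr 1
    · congr 1
      rw [Fintype.sum_prod_type, ← Finset.sum_coe_sort (slice S j)]
      refine Finset.sum_congr rfl fun p _ => Finset.sum_congr rfl fun l _ => ?_
      simp only [Matrix.vec, Matrix.mul_assoc, Matrix.diagonal_mul, mul_pow]
      rfl
    · congr 1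
      rw [Fintype.sum_prod_type, Finset.sum_comm, ← Finset.sum_coe_sort (slice S j)]
      refine Finset.sum_congr rfl fun p _ => Finset.sum_congr rfl fun q _ => ?_
      simp only [Matrix.vec, Matrix.mul_diagonal, mul_pow]
      rw [mul_comm]
      rfl
  · congr 1
    rw [Fintype.sum_prod_type, Finset.sum_comm]
    refine Finset.sum_congr rfl fun l _ => Finset.sum_congr rfl fun q _ => ?_
    simp only [Matrix.vec, Matrix.mul_diagonal, Matrix.diagonal_mul]
    ring

/-- The contribution of one sample `(a, b)` with value `β` to the regularized objective: the
squared residual plus the quadratic terms coming from the variations of the outer factors. -/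
noncomputable def entryObjective (nN : ℕ) (ω γL γR : ℝ) (L : Matrix (Fin nL) (Fin rL) ℝ)
    (σL : Fin rL → ℝ) (σR : Fin rR → ℝ) (R : Matrix (Fin rR) (Fin nR) ℝ) (a : Fin nL)
    (b : Fin nR) (β : ℝ) (X : Matrix (Fin rL) (Fin rR) ℝ) : ℝ :=
  ((∑ l, ∑ q, L a l * X l q * R q b) - β) ^ 2 +
    (∑ l, (γL * ω / σL l * ∑ q, X l q * R q b) ^ 2) / ((totalSize nL nN nR rL rR : ℝ) + 2) +
    (∑ q, (γR * ω / σR q * ∑ l, L a l * X l q) ^ 2) / ((totalSize nL nN nR rL rR : ℝ) + 2) +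
    (∑ l, ∑ q, (γL * ω / σL l * (γR * ω / σR q) * X l q) ^ 2) /
      (((totalSize nL nN nR rL rR : ℝ) + 2) * ((totalSize nL nN nR rL rR : ℝ) + 4))

/-- The objective of slice `j` as a sum over its samples; the factors `nL`, `rL`, `nR`, `rR` of the
constants cancel. -/
lemma sliceObjective_eq (ω γL γR : ℝ) (B : Core nN nL nR)
    (S : Finset (Fin nL × Fin nN × Fin nR)) (hL : ∀ l, σL l ≠ 0) (hR : ∀ q, σR q ≠ 0)
    (j : Fin nN) (X : Matrix (Fin rL) (Fin rR) ℝ) :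
    sliceObjective ω γL γR B S L σL σR R j X =
      ∑ p ∈ slice S j, entryObjective nN ω γL γR L σL σR R p.1 p.2 (B j p.1 p.2) X := by
  simp only [entryObjective]
  rw [sliceObjective, sum_regMatrix_mulVec_sq ω γL γR S hL hR, Finset.sum_add_distrib,
    Finset.sum_add_distrib, Finset.sum_add_distrib, ← add_assoc, ← add_assoc]
  congr 1
  · congr 1
    · congr 1
      · refine Finset.sum_congr rfl fun p _ => ?_
        simp only [Matrix.sub_apply, Matrix.mul_apply, Finset.sum_mul]
        rw [Finset.sum_comm]
      · rw [Finset.mul_sum]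
        refine Finset.sum_congr rfl fun p _ => ?_
        rw [Finset.mul_sum, Finset.sum_div]
        refine Finset.sum_congr rfl fun l _ => ?_
        -- The index types witness that the sizes in the denominators are positive.
        have h1 : (nL : ℝ) ≠ 0 := by exact_mod_cast (Fin.pos p.1).ne'
        have h2 : (rL : ℝ) ≠ 0 := by exact_mod_cast (Fin.pos l).ne'
        have h3 := hL l
        rw [Real.sq_sqrt (by rw [zeta₁]; positivity), zeta₁]
        push_cast
        field_simp
    · rw [Finset.mul_sum]
      refine Finset.sum_congr rfl fun p _ => ?_
      rw [Finset.mul_sum, Finset.sum_div]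
      refine Finset.sum_congr rfl fun q _ => ?_
      have h1 : (nR : ℝ) ≠ 0 := by exact_mod_cast (Fin.pos p.2).ne'
      have h2 : (rR : ℝ) ≠ 0 := by exact_mod_cast (Fin.pos q).ne'
      have h3 := hR q
      rw [Real.sq_sqrt (by rw [zeta₂]; positivity), zeta₂]
      push_cast
      field_simp
  · rw [Finset.sum_const, nsmul_eq_mul]
    rcases (slice S j).eq_empty_or_nonempty with h | ⟨p, -⟩
    · simp [h, rho₁₂]
    rw [Finset.mul_sum, Finset.sum_div, Finset.mul_sum]
    refine Finset.sum_congr rfl fun l _ => ?_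
    rw [Finset.mul_sum, Finset.sum_div, Finset.mul_sum]
    refine Finset.sum_congr rfl fun q _ => ?_
    have h1 : (nL : ℝ) ≠ 0 := by exact_mod_cast (Fin.pos p.1).ne'
    have h2 : (rL : ℝ) ≠ 0 := by exact_mod_cast (Fin.pos l).ne'
    have h3 : (nR : ℝ) ≠ 0 := by exact_mod_cast (Fin.pos p.2).ne'
    have h4 : (rR : ℝ) ≠ 0 := by exact_mod_cast (Fin.pos q).ne'
    have h5 := hL l
    have h6 := hR q
    rw [Real.sq_sqrt (by rw [zeta₁₂, rho₁₂]; positivity), zeta₁₂, rho₁₂]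
    push_cast
    field_simp

/-- Averaging over the variation set gives, up to a positive factor and an additive constant, the
sum of the regularized objectives of the slices. -/
theorem IsStandardRep.exists_averagedResidual_eq (hA : IsStandardRep A L σL N σR R) {ω : ℝ}
    (hω : 0 < ω) (γL γR : ℝ) (B : Core nN nL nR) (S : Finset (Fin nL × Fin nN × Fin nR)) :
    ∃ C c : ℝ, 0 < c ∧ ∀ X : Core nN rL rR,
      averagedResidual ω γL γR B S L (scaledCore σL N σR) R X =
        C + c * ∑ j, sliceObjective ω γL γR B S L σL σR R j (X j) := by
  have hL : ∀ l, σL l ≠ 0 := fun l => (hA.svd_left.pos l).ne'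
  have hR : ∀ q, σR q ≠ 0 := fun q => (hA.svd_right.pos q).ne'
  have := isAddHaarMeasure_volume_variation (nL := nL) (nN := nN) (nR := nR) (rL := rL) (rR := rR)
  obtain ⟨c, hc, hint⟩ := exists_setIntegral_eq_smul
    (volume : Measure (Variation nL nN nR rL rR)) (scaledCoords hω.ne' hL hR) (unitBall _)
  have hentry : ∀ p : Fin nL × Fin nN × Fin nR, _ := fun p =>
    integral_sq_entry (iL := fun l : Fin rL => (p.1, l)) (Prod.mk_right_injective p.1)
      (fun (l : Fin rL) (q : Fin rR) => (p.2.1, l, q)) (iR := fun q : Fin rR => (q, p.2.2))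
      (Prod.mk_left_injective p.2.2) (L p.1) (fun l => γL * ω / σL l) (fun q => R q p.2.2)
      (fun q => γR * ω / σR q) ω (B p.2.1 p.1 p.2.2)
  choose C hC using hentry
  refine ⟨c * ∑ p ∈ S, C p, c * ballVolume (VariationIndex nL nN nR rL rR),
    mul_pos hc ballVolume_pos, fun X => ?_⟩
  rw [averagedResidual, hA.variationSet_eq hω.ne' hL hR, hint, mul_assoc, ← mul_add]
  congr 1
  simp only [sliceObjective_eq ω γL γR B S hL hR]
  rw [← sum_slice S fun a j b => entryObjective nN ω γL γR L σL σR R a b (B j a b) (X j),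
    Finset.mul_sum, ← Finset.sum_add_distrib]
  simp_rw [variedResidual_eq]
  rw [integral_finsetSum]
  · refine Finset.sum_congr rfl fun p _ => ?_
    have h := hC p (X p.2.1)
    rw [card_variationIndex] at h
    rw [entryObjective, ← h]
    refine integral_congr_ae (ae_of_all _ fun y => ?_)
    have h1 : ∀ l, γL * (ω / σL l * y (.inl (p.1, l))) = γL * ω / σL l * y (.inl (p.1, l)) :=
      fun l => by ring
    have h2 : ∀ q, γR * (ω / σR q * y (.inr (.inr (q, p.2.2)))) =
        γR * ω / σR q * y (.inr (.inr (q, p.2.2))) := fun q => by ring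
    simp only [← h1, ← h2]
    rfl
  · intro p _
    refine integrableOn_unitBall ?_
    have hcont : Continuous (scaledCoords (nL := nL) (nN := nN) (nR := nR) hω.ne' hL hR).symm :=
      LinearMap.continuous_of_finiteDimensional
        (scaledCoords (nL := nL) (nN := nN) (nR := nR) hω.ne' hL hR).symm.toLinearMap
    fun_prop

end Objective

/-! ### Minimization -/

section Minimization

/-- Pythagoras for linear least squares: the residual splits at a projection of the target. -/
lemma exists_leastSquares_split {E F : Type*} [AddCommGroup E] [Module ℝ E]
    [NormedAddCommGroup F] [InnerProductSpace ℝ F] [FiniteDimensional ℝ F] (T : E →ₗ[ℝ] F)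
    (b : F) : ∃ x₀, ∀ x, ‖T x - b‖ ^ 2 = ‖T (x - x₀)‖ ^ 2 + ‖T x₀ - b‖ ^ 2 := by
  obtain ⟨x₀, hx₀⟩ := (LinearMap.range T).starProjection_apply_mem b
  refine ⟨x₀, fun x => ?_⟩
  have horth : inner ℝ (T (x - x₀)) (T x₀ - b) = 0 := by
    have h := (LinearMap.range T).sub_starProjection_mem_orthogonal b
    rw [← hx₀] at h
    have h2 := (Submodule.mem_orthogonal _ _).1 h (T (x - x₀)) ⟨_, rfl⟩
    rw [← neg_sub b, inner_neg_right, h2, neg_zero]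
  have hsum : T x - b = T (x - x₀) + (T x₀ - b) := by
    rw [map_sub]; abel
  rw [hsum, sq, sq, sq, norm_add_sq_eq_norm_sq_add_norm_sq_real horth]

/-- A separable sum is minimized exactly by minimizing each summand. -/
lemma isMinOn_sum_iff {ι α : Type*} [Fintype ι] {f : ι → α → ℝ} {C c : ℝ} (hc : 0 < c)
    {F : (ι → α) → ℝ} (hF : ∀ x, F x = C + c * ∑ j, f j (x j)) (x : ι → α) :
    IsMinOn F univ x ↔ ∀ j, IsMinOn (f j) univ (x j) := by
  classical
  simp only [isMinOn_univ_iff, hF, add_le_add_iff_left, mul_le_mul_iff_right₀ hc]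
  refine ⟨fun h j a => ?_, fun h y => Finset.sum_le_sum fun j _ => h j (y j)⟩
  have h1 := h (Function.update x j a)
  rw [← Finset.add_sum_erase _ _ (Finset.mem_univ j),
    ← Finset.add_sum_erase _ _ (Finset.mem_univ j)] at h1
  have h2 : ∑ i ∈ Finset.univ.erase j, f i (Function.update x j a i) =
      ∑ i ∈ Finset.univ.erase j, f i (x i) :=
    Finset.sum_congr rfl fun i hi => by
      rw [Function.update_of_ne (Finset.ne_of_mem_erase hi)]
  rw [h2, Function.update_self] at h1
  linarith

lemma frobSq_nonneg {m n : Type*} [Fintype m] [Fintype n] (X : Matrix m n ℝ) : 0 ≤ frobSq X :=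
  Finset.sum_nonneg fun _ _ => Finset.sum_nonneg fun _ _ => sq_nonneg _

lemma coreFrobSq_nonneg {n k₁ k₂ : ℕ} (H : Core n k₁ k₂) : 0 ≤ coreFrobSq H :=
  Finset.sum_nonneg fun _ _ => frobSq_nonneg _

lemma frobSq_eq_zero {m n : Type*} [Fintype m] [Fintype n] {X : Matrix m n ℝ} :
    frobSq X = 0 ↔ X = 0 := by
  refine ⟨fun h => ?_, fun h => by simp [h, frobSq]⟩
  ext a b
  have h1 := (Finset.sum_eq_zero_iff_of_nonneg fun a _ =>
    Finset.sum_nonneg fun b _ => sq_nonneg (X a b)).1 h a (Finset.mem_univ a)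
  have h2 := (Finset.sum_eq_zero_iff_of_nonneg fun b _ => sq_nonneg (X a b)).1 h1 b
    (Finset.mem_univ b)
  simpa using h2

variable {nL nN nR rL rR : ℕ} {L : Matrix (Fin nL) (Fin rL) ℝ}
  {σL : Fin rL → ℝ} {σR : Fin rR → ℝ} {R : Matrix (Fin rR) (Fin nR) ℝ}

lemma sliceObjective_eq_zero (ω γL γR : ℝ) (B : Core nN nL nR)
    {S : Finset (Fin nL × Fin nN × Fin nR)} (hL : ∀ l, σL l ≠ 0) (hR : ∀ q, σR q ≠ 0)
    {j : Fin nN} (hj : slice S j = ∅) (X : Matrix (Fin rL) (Fin rR) ℝ) :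
    sliceObjective ω γL γR B S L σL σR R j X = 0 := by
  simp [sliceObjective_eq ω γL γR B S hL hR, hj]

/-- The third block of the regularizer is injective as soon as slice `j` is sampled. -/
lemma eq_zero_of_regMatrix_mulVec_eq_zero {ω γL γR : ℝ} (hω : 0 < ω) (hγL : 0 < γL)
    (hγR : 0 < γR) {S : Finset (Fin nL × Fin nN × Fin nR)} (hL : ∀ l, σL l ≠ 0)
    (hR : ∀ q, σR q ≠ 0) {j : Fin nN} (hj : (slice S j).Nonempty)
    {X : Matrix (Fin rL) (Fin rR) ℝ}
    (h : (regMatrix ω γL γR S L σL σR R j).mulVec X.vec = 0) : X = 0 := by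
  ext l q
  have h1 := sum_regMatrix_mulVec_sq (L := L) (R := R) ω γL γR S hL hR j X
  simp only [h, Pi.zero_apply, ne_eq, OfNat.ofNat_ne_zero, not_false_eq_true, zero_pow,
    Finset.sum_const_zero] at h1
  obtain ⟨p, hp⟩ := hj
  have n1 : (0 : ℝ) < nL := by exact_mod_cast Fin.pos p.1
  have n2 : (0 : ℝ) < nR := by exact_mod_cast Fin.pos p.2
  have n3 : (0 : ℝ) < rL := by exact_mod_cast Fin.pos l
  have n4 : (0 : ℝ) < rR := by exact_mod_cast Fin.pos q
  have n5 : (0 : ℝ) < (slice S j).card := by exact_mod_cast Finset.card_pos.2 ⟨p, hp⟩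
  have hpos : 0 < √(rho₁₂ S j * zeta₁₂ nL nN nR rL rR ω γL γR) ^ 2 := by
    have : 0 < rho₁₂ S j * zeta₁₂ nL nN nR rL rR ω γL γR := by
      rw [rho₁₂, zeta₁₂]
      push_cast
      positivity
    positivity
  have h2 : ∑ l, ∑ q, ((σL l)⁻¹ * (σR q)⁻¹ * X l q) ^ 2 = 0 := by
    have a1 : 0 ≤ ∑ l, ∑ q, ((σL l)⁻¹ * (σR q)⁻¹ * X l q) ^ 2 := by positivity
    have a2 : 0 ≤ √((nL : ℝ)⁻¹ * zeta₁ nL nN nR rL rR ω γL) ^ 2 *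
        (∑ p ∈ slice S j, ∑ l, ((σL l)⁻¹ * ∑ q, X l q * R q p.2) ^ 2) := by positivity
    have a3 : 0 ≤ √((nR : ℝ)⁻¹ * zeta₂ nL nN nR rL rR ω γR) ^ 2 *
        (∑ p ∈ slice S j, ∑ q, ((σR q)⁻¹ * ∑ l, L p.1 l * X l q) ^ 2) := by positivity
    have a4 := mul_nonneg hpos.le a1
    exact (mul_eq_zero.1 (by linarith : _ * _ = (0 : ℝ))).resolve_left hpos.ne'
  have h3 := congrFun (congrFun ((frobSq_eq_zero (X := Matrix.of fun l q =>
    (σL l)⁻¹ * (σR q)⁻¹ * X l q)).1 h2) l) q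
  simpa [hL, hR] using h3

lemma existsUnique_isMinOn_sliceObjective {ω γL γR : ℝ} (hω : 0 < ω) (hγL : 0 < γL)
    (hγR : 0 < γR) (B : Core nN nL nR) {S : Finset (Fin nL × Fin nN × Fin nR)}
    (hL : ∀ l, σL l ≠ 0) (hR : ∀ q, σR q ≠ 0) {j : Fin nN} (hj : (slice S j).Nonempty) :
    ∃! X, IsMinOn (sliceObjective ω γL γR B S L σL σR R j) univ X := by
  set Y := regMatrix ω γL γR S L σL σR R j with hY
  -- The objective is the squared norm of one stacked linear residual.
  let T : Matrix (Fin rL) (Fin rR) ℝ →ₗ[ℝ] EuclideanSpace ℝ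
      (slice S j ⊕ ((slice S j × Fin rL) ⊕ (Fin rR × slice S j) ⊕ (Fin rR × Fin rL))) :=
    { toFun := fun X => WithLp.toLp 2
        (Sum.elim (fun p => (L * X * R) p.1.1 p.1.2) (Y.mulVec X.vec))
      map_add' := fun X X' => by
        ext (p | i) <;> simp [Matrix.mul_add, Matrix.add_mul, Matrix.vec_add, Matrix.mulVec_add]
      map_smul' := fun t X => by
        ext (p | i) <;> simp [Matrix.vec_smul, Matrix.mulVec_smul] }
  have hT : ∀ X, sliceObjective ω γL γR B S L σL σR R j X = ‖T X - WithLp.toLp 2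
      (Sum.elim (fun p => B j p.1.1 p.1.2) 0)‖ ^ 2 := by
    intro X
    simp only [EuclideanSpace.norm_sq_eq, Fintype.sum_sum_type, Real.norm_eq_abs, sq_abs]
    rw [sliceObjective, ← Finset.sum_coe_sort (slice S j)]
    simp [T, hY]
  obtain ⟨X₀, hX₀⟩ := exists_leastSquares_split T
    (WithLp.toLp 2 (Sum.elim (fun p => B j p.1.1 p.1.2) 0))
  simp only [isMinOn_univ_iff, hT]
  refine ⟨X₀, fun X => ?_, fun X hX => ?_⟩
  · rw [hX₀ X]
    exact le_add_of_nonneg_left (sq_nonneg _)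
  · have h1 := hX X₀
    rw [hX₀ X] at h1
    have h2 : ‖T (X - X₀)‖ ^ 2 = 0 := le_antisymm (by linarith) (sq_nonneg _)
    have h3 : T (X - X₀) = 0 := by simpa using h2
    refine sub_eq_zero.1 (eq_zero_of_regMatrix_mulVec_eq_zero (L := L) (R := R) hω hγL hγR hL hR
      hj ?_)
    ext i
    exact congrFun (congrArg WithLp.ofLp h3) (Sum.inr i)

end Minimization

end TTALS

theorem theorem4p6 {nL nN nR rL rR : ℕ} (ω γL γR : ℝ) (hω : 0 < ω) (hγL : 0 < γL) (hγR : 0 < γR)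
    (A B : TTALS.Core nN nL nR) (S : Finset (Fin nL × Fin nN × Fin nR))
    (L : Matrix (Fin nL) (Fin rL) ℝ) (σL : Fin rL → ℝ) (N : TTALS.Core nN rL rR)
    (σR : Fin rR → ℝ) (R : Matrix (Fin rR) (Fin nR) ℝ)
    (hA : TTALS.IsStandardRep A L σL N σR R) :
    -- the integrals defining the averaged residual function exist
    (∀ X : TTALS.Core nN rL rR,
      MeasureTheory.IntegrableOn (TTALS.variedResidual γL γR B S L R X)
        (TTALS.variationSet ω L (TTALS.scaledCore σL N σR) R)) ∧
    -- a core minimizes it iff each of its slices minimizes the regularized objective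
    (∀ X : TTALS.Core nN rL rR,
      IsMinOn (TTALS.averagedResidual ω γL γR B S L (TTALS.scaledCore σL N σR) R) Set.univ X ↔
        ∀ j, IsMinOn (TTALS.sliceObjective ω γL γR B S L σL σR R j) Set.univ (X j)) ∧
    -- the minimizing slice is unique wherever there are samples
    (∀ j, (TTALS.slice S j).Nonempty →
      ∃! X, IsMinOn (TTALS.sliceObjective ω γL γR B S L σL σR R j) Set.univ X) ∧
    -- with the norm of the generated tensor as secondary criterion, the minimizer is unique, and
    -- its slices are the unique minimizers of the regularized objectives
    ∃ Nplus : TTALS.Core nN rL rR,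
      (∀ X, TTALS.IsArgmin (TTALS.averagedResidual ω γL γR B S L (TTALS.scaledCore σL N σR) R)
          (fun X => √(TTALS.coreFrobSq (TTALS.tau L X R))) X ↔ X = Nplus) ∧
      ∀ j X, TTALS.IsArgmin (TTALS.sliceObjective ω γL γR B S L σL σR R j)
          (fun X => √(TTALS.frobSq (L * X * R))) X ↔ X = Nplus j := by
  have hL : ∀ l, σL l ≠ 0 := fun l => (hA.svd_left.pos l).ne'
  have hR : ∀ q, σR q ≠ 0 := fun q => (hA.svd_right.pos q).ne'
  obtain ⟨C, c, hc, hC⟩ := hA.exists_averagedResidual_eq hω γL γR B S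
  have hiff := TTALS.isMinOn_sum_iff hc hC
  have huniq : ∀ j, (TTALS.slice S j).Nonempty →
      ∃! X, IsMinOn (TTALS.sliceObjective ω γL γR B S L σL σR R j) Set.univ X := fun j hj =>
    TTALS.existsUnique_isMinOn_sliceObjective hω hγL hγR B hL hR hj
  refine ⟨hA.integrableOn_variedResidual hω γL γR B S, hiff, huniq, ?_⟩
  -- On slices without samples the objective vanishes, and the secondary criterion selects `0`.
  have hex : ∀ j, ∃ M : Matrix (Fin rL) (Fin rR) ℝ,
      IsMinOn (TTALS.sliceObjective ω γL γR B S L σL σR R j) Set.univ M ∧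
      ∀ X, IsMinOn (TTALS.sliceObjective ω γL γR B S L σL σR R j) Set.univ X →
        TTALS.frobSq M ≤ TTALS.frobSq X ∧ (TTALS.frobSq X ≤ TTALS.frobSq M → X = M) := by
    intro j
    rcases (TTALS.slice S j).eq_empty_or_nonempty with hj | hj
    · refine ⟨0, fun X _ => ?_, fun X _ => ?_⟩
      · simp [TTALS.sliceObjective_eq_zero ω γL γR B hL hR hj]
      · rw [TTALS.frobSq_eq_zero.2 rfl]
        exact ⟨TTALS.frobSq_nonneg X,
          fun h => TTALS.frobSq_eq_zero.1 (le_antisymm h (TTALS.frobSq_nonneg X))⟩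
    · obtain ⟨M, hM, hu⟩ := huniq j hj
      exact ⟨M, hM, fun X hX => by rw [hu X hX]; exact ⟨le_rfl, fun _ => rfl⟩⟩
  choose M hM hMX using hex
  simp only [TTALS.IsArgmin, hA.frobSq_mul_mul, hA.coreFrobSq_tau]
  refine ⟨M, fun X => ⟨fun ⟨h1, h2⟩ => ?_, ?_⟩, fun j X => ⟨fun ⟨h1, h2⟩ => ?_, ?_⟩⟩
  · rw [hiff] at h1
    have h3 : √(TTALS.coreFrobSq X) ≤ √(TTALS.coreFrobSq M) := h2 ((hiff M).2 hM)
    rw [Real.sqrt_le_sqrt_iff (TTALS.coreFrobSq_nonneg M)] at h3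
    have h4 := (Finset.sum_eq_sum_iff_of_le fun j _ => (hMX j (X j) (h1 j)).1).1
      (le_antisymm (Finset.sum_le_sum fun j _ => (hMX j (X j) (h1 j)).1) h3)
    funext j
    exact (hMX j (X j) (h1 j)).2 (h4 j (Finset.mem_univ j)).ge
  · rintro rfl
    refine ⟨(hiff X).2 hM, fun Z hZ => Real.sqrt_le_sqrt ?_⟩
    exact Finset.sum_le_sum fun j _ => (hMX j (Z j) ((hiff Z).1 hZ j)).1
  · have h3 : √(TTALS.frobSq X) ≤ √(TTALS.frobSq (M j)) := h2 (hM j)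
    rw [Real.sqrt_le_sqrt_iff (TTALS.frobSq_nonneg _)] at h3
    exact (hMX j X h1).2 h3
  · rintro rfl
    exact ⟨hM j, fun Z hZ => Real.sqrt_le_sqrt (hMX j Z hZ).1⟩
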